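/- Let $k \ge 2$, let $G = \mathbb{Z}/k\mathbb{Z}$, let $\Gamma = \widehat{G} \cong \mathbb{Z}/k\mathbb{Z}$ be its dual group, and fix a generator $\mu$ of $\Gamma$. Let $A$ be a unital $C^*$-algebra with a free action $\alpha$ of $G$ by $*$-automorphisms, where, writing $A_\gamma = \{a \in A : \alpha_g(a) = \gamma(g)a \text{ for all } g \in G\}$ for the $\gamma$-isotypic subspace, free means that $1 \in \overline{\operatorname{span}}\, A_\gamma A_\gamma^*$ for every $\gamma \in \Gamma$. Suppose that there is a unitary $x \in A_\mu$ with $x^k = 1$. Let $\beta$ be an action of $\Gamma \cong \mathbb{Z}/k\mathbb{Z}$ on $A$ by $*$-automorphisms which commutes with $\alpha$, such that the closed two-sided ideal $I$ generated by the elements $\beta_\gamma(a) - a$ ($\gamma \in \Gamma$, $a \in A$) is proper, and such that the class $[1] \in K_0(A/I)$ is not divisible by $k$, that is, there is no $y \in K_0(A/I)$ with $k y = [1]$. Let $A \rtimes_\beta \Gamma = \{\sum_{\gamma \in \Gamma} a_\gamma \gamma : a_\gamma \in A\}$ be the crossed product, with the relations $a\gamma = \gamma\beta_\gamma(a)$ and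 $\gamma^* = \gamma^{-1}$, and with its unique $C^*$-norm. Let $$J(A,\beta) = \{f \in C([0,1], A \rtimes_\beta \Gamma) : f(0) \in C^*(\Gamma),\ f(1) \in A\}$$ be the $\beta$-twisted join, where $C^*(\Gamma) = \{\sum_\gamma c_\gamma \gamma : c_\gamma \in \mathbb{C}\}$, and let $\widetilde{\alpha}$ be the action of $G$ on $J(A,\beta)$ given by pointwise application of $\sum_\gamma a_\gamma \gamma \mapsto \sum_\gamma \gamma(g)\,\alpha_g(a_\gamma)\,\gamma$, $g \in G$. Then there is no $(\alpha, \widetilde{\alpha})$-equivariant unital $*$-homomorphism $A \to J(A,\beta)$, i.e. no unital $*$-homomorphism $\phi$ with $\phi \circ \alpha_g = \widetilde{\alpha}_g \circ \phi$ for all $g \in G$. -/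

import Mathlib

open scoped Matrix CStarAlgebra

set_option linter.unusedSectionVars false
set_option linter.style.haveILetI false

/-! ### The group `K₀` of a unital `*`-ring -/

namespace KZero

section Relation

variable {B : Type*} [Ring B] [StarRing B]

/-- Murray-von Neumann equivalence of square matrices `p`, `q`, possibly of different sizes:
`p = v v*` and `q = v* v` for some rectangular matrix `v` over `B`. -/
def MvN {m n : Type*} [Fintype m] [Fintype n] (p : Matrix m m B) (q : Matrix n n B) : Prop :=
  ∃ v : Matrix m n B, v * vᴴ = p ∧ vᴴ * v = q

theorem MvN.refl {m : Type*} [Fintype m] {p : Matrix m m B} (hp : IsStarProjection p) :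
    MvN p p := by
  have h1 : pᴴ = p := hp.isSelfAdjoint
  have h2 : p * p = p := hp.isIdempotentElem
  exact ⟨p, by rw [h1, h2], by rw [h1, h2]⟩

theorem MvN.symm {m n : Type*} [Fintype m] [Fintype n] {p : Matrix m m B} {q : Matrix n n B}
    (h : MvN p q) : MvN q p := by
  obtain ⟨v, h1, h2⟩ := h
  exact ⟨vᴴ, by rw [Matrix.conjTranspose_conjTranspose, h2],
    by rw [Matrix.conjTranspose_conjTranspose, h1]⟩

theorem MvN.trans {l m n : Type*} [Fintype l] [Fintype m] [Fintype n] {p : Matrix l l B}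
    {q : Matrix m m B} {r : Matrix n n B} (hp : IsStarProjection p) (hr : IsStarProjection r)
    (h : MvN p q) (h' : MvN q r) : MvN p r := by
  obtain ⟨v, h1, h2⟩ := h
  obtain ⟨w, h3, h4⟩ := h'
  have e1 : p * p = p := hp.isIdempotentElem
  have e2 : r * r = r := hr.isIdempotentElem
  refine ⟨v * w, ?_, ?_⟩
  · calc v * w * (v * w)ᴴ = v * (w * wᴴ) * vᴴ := by
          rw [Matrix.conjTranspose_mul]; simp only [Matrix.mul_assoc]
      _ = (v * vᴴ) * (v * vᴴ) := by rw [h3, ← h2]; simp only [Matrix.mul_assoc]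
      _ = p := by rw [h1, e1]
  · calc (v * w)ᴴ * (v * w) = wᴴ * (vᴴ * v) * w := by
          rw [Matrix.conjTranspose_mul]; simp only [Matrix.mul_assoc]
      _ = (wᴴ * w) * (wᴴ * w) := by rw [h2, ← h3]; simp only [Matrix.mul_assoc]
      _ = r := by rw [h4, e2]

/-- Relabelling rows and columns does not change the equivalence class. -/
theorem MvN.reindex {m n : Type*} [Fintype m] [Fintype n] [DecidableEq n] {p : Matrix m m B}
    (hp : IsStarProjection p) (e : m ≃ n) : MvN p (p.submatrix e.symm e.symm) := by
  have h1 : pᴴ = p := hp.isSelfAdjoint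
  have h2 : p * p = p := hp.isIdempotentElem
  refine ⟨p.submatrix id e.symm, ?_, ?_⟩
  · rw [Matrix.conjTranspose_submatrix, h1, Matrix.submatrix_mul_equiv, h2]; rfl
  · rw [Matrix.conjTranspose_submatrix, h1,
      ← Matrix.submatrix_mul p p e.symm id e.symm Function.bijective_id, h2]

theorem isStarProjection_submatrix {m n : Type*} [Fintype m] [Fintype n] {p : Matrix m m B}
    (hp : IsStarProjection p) (e : n ≃ m) : IsStarProjection (p.submatrix e e) := by
  have h1 : pᴴ = p := hp.isSelfAdjoint
  have h2 : p * p = p := hp.isIdempotentElem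
  refine ⟨?_, ?_⟩
  · change p.submatrix e e * p.submatrix e e = _
    rw [Matrix.submatrix_mul_equiv, h2]
  · change (p.submatrix e e)ᴴ = _
    rw [Matrix.conjTranspose_submatrix, h1]

/-- The block diagonal matrix with blocks `p` and `q`. -/
def block {m n : Type*} (p : Matrix m m B) (q : Matrix n n B) : Matrix (m ⊕ n) (m ⊕ n) B :=
  Matrix.fromBlocks p 0 0 q

theorem isStarProjection_block {m n : Type*} [Fintype m] [Fintype n] {p : Matrix m m B}
    {q : Matrix n n B} (hp : IsStarProjection p) (hq : IsStarProjection q) :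
    IsStarProjection (block p q) := by
  have h1 : pᴴ = p := hp.isSelfAdjoint
  have h2 : p * p = p := hp.isIdempotentElem
  have h3 : qᴴ = q := hq.isSelfAdjoint
  have h4 : q * q = q := hq.isIdempotentElem
  refine ⟨?_, ?_⟩
  · change block p q * block p q = block p q
    simp [block, Matrix.fromBlocks_multiply, h2, h4]
  · change (block p q)ᴴ = block p q
    simp [block, Matrix.fromBlocks_conjTranspose, h1, h3]

theorem MvN.block {m n m' n' : Type*} [Fintype m] [Fintype n] [Fintype m'] [Fintype n']
    {p : Matrix m m B} {q : Matrix n n B} {p' : Matrix m' m' B} {q' : Matrix n' n' B}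
    (h : MvN p p') (h' : MvN q q') : MvN (KZero.block p q) (KZero.block p' q') := by
  obtain ⟨v, h1, h2⟩ := h
  obtain ⟨w, h3, h4⟩ := h'
  refine ⟨Matrix.fromBlocks v 0 0 w, ?_, ?_⟩
  · simp [KZero.block, Matrix.fromBlocks_conjTranspose, Matrix.fromBlocks_multiply, h1, h3]
  · simp [KZero.block, Matrix.fromBlocks_conjTranspose, Matrix.fromBlocks_multiply, h2, h4]

end Relation

section Group

variable (B : Type*) [Ring B] [StarRing B]

/-- Projections in the matrix algebras `Mₙ(B)`, `n = 0, 1, 2, …`. -/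
def Proj : Type _ := Σ n : ℕ, {p : Matrix (Fin n) (Fin n) B // IsStarProjection p}

instance projSetoid : Setoid (Proj B) where
  r p q := MvN p.2.1 q.2.1
  iseqv :=
    { refl := fun p => MvN.refl p.2.2
      symm := fun h => h.symm
      trans := fun {p _ r} h h' => MvN.trans p.2.2 r.2.2 h h' }

variable {B} in
/-- The orthogonal sum `diag(p, q)` of two projections. -/
def Proj.add (p q : Proj B) : Proj B :=
  ⟨p.1 + q.1, (block p.2.1 q.2.1).submatrix finSumFinEquiv.symm finSumFinEquiv.symm,
    isStarProjection_submatrix (isStarProjection_block p.2.2 q.2.2) _⟩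

variable {B} in
theorem Proj.add_mvN (p q : Proj B) : MvN (block p.2.1 q.2.1) (p.add q).2.1 :=
  MvN.reindex (isStarProjection_block p.2.2 q.2.2) finSumFinEquiv

/-- The projection `0` in the matrices of size `0`. -/
def Proj.zero : Proj B := ⟨0, 0, IsStarProjection.zero _⟩

/-- The projection `1` in `M₁(B)`. -/
def Proj.one : Proj B := ⟨1, 1, IsStarProjection.one _⟩

/-- The semigroup of Murray-von Neumann classes of projections in matrices over `B`. -/
def ProjClass : Type _ := Quotient (projSetoid B)

instance : Zero (ProjClass B) := ⟨Quotient.mk _ (Proj.zero B)⟩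

variable {B} in
theorem Proj.equiv_of_block {p q r : Proj B} (h : MvN (block p.2.1 q.2.1) r.2.1) :
    p.add q ≈ r :=
  MvN.trans (p.add q).2.2 r.2.2 (Proj.add_mvN p q).symm h

instance : Add (ProjClass B) :=
  ⟨Quotient.map₂ Proj.add fun p p' h q q' h' =>
    Proj.equiv_of_block (MvN.trans (isStarProjection_block p.2.2 q.2.2)
      (p'.add q').2.2 (MvN.block h h') (Proj.add_mvN p' q'))⟩

variable {B} in
theorem Proj.zero_add_equiv (p : Proj B) : (Proj.zero B).add p ≈ p := by
  refine Proj.equiv_of_block (MvN.symm ?_)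
  have h := MvN.reindex p.2.2 (Equiv.emptySum (Fin 0) (Fin p.1)).symm
  have e : KZero.block (Proj.zero B).2.1 p.2.1 =
      p.2.1.submatrix (Equiv.emptySum (Fin 0) (Fin p.1)).symm.symm
        (Equiv.emptySum (Fin 0) (Fin p.1)).symm.symm := by
    refine Matrix.ext fun i j => ?_
    rcases i with i | i
    · exact Fin.elim0 i
    rcases j with j | j
    · exact Fin.elim0 j
    rfl
  rw [e]
  exact h

variable {B} in
theorem Proj.add_comm_equiv (p q : Proj B) : p.add q ≈ q.add p := by
  refine Proj.equiv_of_block (MvN.trans (isStarProjection_block p.2.2 q.2.2)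
      (q.add p).2.2 ?_ (Proj.add_mvN q p))
  have h := MvN.reindex (isStarProjection_block p.2.2 q.2.2) (Equiv.sumComm (Fin p.1) (Fin q.1))
  convert h using 1
  ext (i | i) (j | j) <;> rfl

variable {B} in
theorem Proj.add_assoc_equiv (p q r : Proj B) : (p.add q).add r ≈ p.add (q.add r) := by
  have hp := p.2.2
  have hq := q.2.2
  have hr := r.2.2
  have h1 : MvN (KZero.block (p.add q).2.1 r.2.1)
      (KZero.block (KZero.block p.2.1 q.2.1) r.2.1) :=
    MvN.block (Proj.add_mvN p q).symm (MvN.refl hr)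
  have h2 : MvN (KZero.block p.2.1 (KZero.block q.2.1 r.2.1))
      (KZero.block p.2.1 (q.add r).2.1) :=
    MvN.block (MvN.refl hp) (Proj.add_mvN q r)
  have h3 : MvN (KZero.block (KZero.block p.2.1 q.2.1) r.2.1)
      (KZero.block p.2.1 (KZero.block q.2.1 r.2.1)) := by
    have h := MvN.reindex (isStarProjection_block (isStarProjection_block hp hq) hr)
      (Equiv.sumAssoc (Fin p.1) (Fin q.1) (Fin r.1))
    convert h using 1
    ext (i | i | i) (j | j | j) <;> rfl
  have b1 := isStarProjection_block (p.add q).2.2 hr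
  have b2 := isStarProjection_block hp (isStarProjection_block hq hr)
  have b3 := isStarProjection_block hp (q.add r).2.2
  exact Proj.equiv_of_block (MvN.trans b1 (p.add (q.add r)).2.2
    (MvN.trans b1 b3 (MvN.trans b1 b2 h1 h3) h2) (Proj.add_mvN p (q.add r)))

instance : AddCommMonoid (ProjClass B) where
  add_assoc := by
    rintro ⟨p⟩ ⟨q⟩ ⟨r⟩
    exact Quotient.sound (Proj.add_assoc_equiv p q r)
  zero_add := by
    rintro ⟨p⟩
    exact Quotient.sound (Proj.zero_add_equiv p)
  add_zero := by
    rintro ⟨p⟩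
    exact Quotient.sound
      (Setoid.trans (Proj.add_comm_equiv p (Proj.zero B)) (Proj.zero_add_equiv p))
  add_comm := by
    rintro ⟨p⟩ ⟨q⟩
    exact Quotient.sound (Proj.add_comm_equiv p q)
  nsmul := nsmulRec

end Group

end KZero

/-- The group `K₀(B)`: the Grothendieck group of the semigroup of Murray-von Neumann classes of
projections in matrices over `B`. -/
abbrev KZeroGroup (B : Type*) [Ring B] [StarRing B] : Type _ :=
  Algebra.GrothendieckAddGroup (KZero.ProjClass B)

/-- The class `[1]` in `K₀(B)` of the unit of `B`. -/
noncomputable def KZeroGroup.unitClass (B : Type*) [Ring B] [StarRing B] : KZeroGroup B :=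
  Algebra.GrothendieckAddGroup.of (Quotient.mk _ (KZero.Proj.one B) : KZero.ProjClass B)

/-! ### Actions on a C*-algebra, isotypic subspaces, saturation -/

section Actions

variable {A : Type*} [CStarAlgebra A] {G : Type*} [AddCommGroup G]

/-- The `γ`-isotypic subspace of an action of `G`, for a character `γ` of `G`. -/
def isotypic (α : Multiplicative G →* (A ≃⋆ₐ[ℂ] A)) (γ : AddChar G ℂ) : Submodule ℂ A where
  carrier := {a | ∀ g : G, α (Multiplicative.ofAdd g) a = γ g • a}
  zero_mem' := fun g => by simp
  add_mem' := fun {a b} ha hb g => by rw [map_add, ha g, hb g, smul_add]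
  smul_mem' := fun c a ha g => by rw [map_smul, ha g, smul_comm]

/-- An action of a finite abelian group is free when it is saturated: for each character `γ`, the
unit lies in the closed linear span of the products `a b*` with `a`, `b` in the `γ`-isotypic
subspace. -/
def IsFreeAction (α : Multiplicative G →* (A ≃⋆ₐ[ℂ] A)) : Prop :=
  ∀ γ : AddChar G ℂ, (1 : A) ∈ (Submodule.span ℂ
    {x : A | ∃ a ∈ isotypic α γ, ∃ b ∈ isotypic α γ, x = a * star b}).topologicalClosure

end Actions

/-! ### The closed ideal generated by the elements `β_γ(a) - a`, and its quotient -/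

section Coinvariants

variable {A : Type*} [CStarAlgebra A] {Γ : Type*} [CommGroup Γ]

/-- The smallest closed two-sided ideal which contains all the elements `β_γ(a) - a`. -/
def coinvariantIdeal (β : Γ →* (A ≃⋆ₐ[ℂ] A)) : TwoSidedIdeal A :=
  sInf {J : TwoSidedIdeal A | IsClosed (J : Set A) ∧ ∀ (γ : Γ) (a : A), β γ a - a ∈ J}

theorem star_mem_coinvariantIdeal (β : Γ →* (A ≃⋆ₐ[ℂ] A)) {x : A}
    (hx : x ∈ coinvariantIdeal β) : star x ∈ coinvariantIdeal β := by
  rw [coinvariantIdeal, TwoSidedIdeal.mem_sInf] at hx ⊢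
  rintro J ⟨hJ, hJ'⟩
  let K : TwoSidedIdeal A := TwoSidedIdeal.mk' {y | star y ∈ J}
    (by
      change star (0 : A) ∈ J
      rw [star_zero]; exact J.zero_mem)
    (fun {y z} hy hz => by
      change star (y + z) ∈ J
      rw [star_add]; exact J.add_mem hy hz)
    (fun {y} hy => by
      change star (-y) ∈ J
      rw [star_neg]; exact J.neg_mem hy)
    (fun {y z} hz => by
      change star (y * z) ∈ J
      rw [star_mul]; exact J.mul_mem_right _ _ hz)
    (fun {y z} hy => by
      change star (y * z) ∈ J
      rw [star_mul]; exact J.mul_mem_left _ _ hy)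
  have hK : ∀ y, y ∈ K ↔ star y ∈ J := fun y => TwoSidedIdeal.mem_mk' ..
  refine (hK x).1 (hx (I := K) ⟨?_, ?_⟩)
  · have : (K : Set A) = star ⁻¹' (J : Set A) := by
      ext y; exact hK y
    rw [this]
    exact hJ.preimage continuous_star
  · intro γ a
    rw [hK, star_sub, ← map_star]
    exact hJ' γ (star a)

/-- The quotient of `A` by the closed ideal generated by the elements `β_γ(a) - a`. -/
def CoinvariantQuotient (β : Γ →* (A ≃⋆ₐ[ℂ] A)) : Type _ := (coinvariantIdeal β).ringCon.Quotient

noncomputable instance (β : Γ →* (A ≃⋆ₐ[ℂ] A)) : Ring (CoinvariantQuotient β) :=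
  inferInstanceAs (Ring (coinvariantIdeal β).ringCon.Quotient)

/-- The quotient map. -/
def CoinvariantQuotient.mk (β : Γ →* (A ≃⋆ₐ[ℂ] A)) : A →+* CoinvariantQuotient β :=
  (coinvariantIdeal β).ringCon.mk'

theorem CoinvariantQuotient.mk_surjective (β : Γ →* (A ≃⋆ₐ[ℂ] A)) :
    Function.Surjective (CoinvariantQuotient.mk β) :=
  RingCon.mk'_surjective (c := (coinvariantIdeal β).ringCon)

theorem CoinvariantQuotient.mk_eq_mk_iff (β : Γ →* (A ≃⋆ₐ[ℂ] A)) (x y : A) :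
    CoinvariantQuotient.mk β x = CoinvariantQuotient.mk β y ↔ x - y ∈ coinvariantIdeal β :=
  (RingCon.eq (coinvariantIdeal β).ringCon).trans (TwoSidedIdeal.rel_iff _ x y)

/-- The involution of the quotient, `star (mk x) = mk (star x)`. -/
noncomputable instance (β : Γ →* (A ≃⋆ₐ[ℂ] A)) : Star (CoinvariantQuotient β) where
  star := Quotient.lift (fun x => CoinvariantQuotient.mk β (star x)) fun x y h => by
    have h' : x - y ∈ coinvariantIdeal β := (TwoSidedIdeal.rel_iff _ x y).1 h
    rw [CoinvariantQuotient.mk_eq_mk_iff, ← star_sub]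
    exact star_mem_coinvariantIdeal β h'

theorem CoinvariantQuotient.star_mk (β : Γ →* (A ≃⋆ₐ[ℂ] A)) (x : A) :
    star (CoinvariantQuotient.mk β x) = CoinvariantQuotient.mk β (star x) := rfl

noncomputable instance (β : Γ →* (A ≃⋆ₐ[ℂ] A)) : StarRing (CoinvariantQuotient β) where
  star_involutive x := by
    obtain ⟨x, rfl⟩ := CoinvariantQuotient.mk_surjective β x
    rw [CoinvariantQuotient.star_mk, CoinvariantQuotient.star_mk, star_star]
  star_mul x y := by
    obtain ⟨x, rfl⟩ := CoinvariantQuotient.mk_surjective β x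
    obtain ⟨y, rfl⟩ := CoinvariantQuotient.mk_surjective β y
    rw [← map_mul, CoinvariantQuotient.star_mk, star_mul, map_mul, CoinvariantQuotient.star_mk,
      CoinvariantQuotient.star_mk]
  star_add x y := by
    obtain ⟨x, rfl⟩ := CoinvariantQuotient.mk_surjective β x
    obtain ⟨y, rfl⟩ := CoinvariantQuotient.mk_surjective β y
    rw [← map_add, CoinvariantQuotient.star_mk, star_add, map_add, CoinvariantQuotient.star_mk,
      CoinvariantQuotient.star_mk]

end Coinvariants

/-! ### The crossed product of a C*-algebra by a finite abelian group -/

section Crossed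

variable {A : Type*} [CStarAlgebra A] {Γ : Type*} [CommGroup Γ]

/-- The crossed product `A ⋊_β Γ` by a finite abelian group `Γ`. The function `f : Γ → A` stands
for the formal sum `∑ γ, f γ · γ`, and the multiplication is determined by `a γ = γ β_γ(a)`. -/
def CrossedProduct (_β : Γ →* (A ≃⋆ₐ[ℂ] A)) : Type _ := Γ → A

namespace CrossedProduct

variable (β : Γ →* (A ≃⋆ₐ[ℂ] A))

noncomputable instance : AddCommGroup (CrossedProduct β) := inferInstanceAs (AddCommGroup (Γ → A))

noncomputable instance : Module ℂ (CrossedProduct β) := inferInstanceAs (Module ℂ (Γ → A))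

variable {β} in
/-- The coefficient `f γ` of `γ` in `f = ∑ γ, f γ · γ`. -/
def coeff (f : CrossedProduct β) (γ : Γ) : A := f γ

/-- The element `∑ γ, f γ · γ` of the crossed product. -/
def ofCoeff (f : Γ → A) : CrossedProduct β := f

variable {β} in
@[ext] theorem ext {f h : CrossedProduct β} (H : ∀ γ, f.coeff γ = h.coeff γ) : f = h := funext H

@[simp] theorem coeff_ofCoeff (f : Γ → A) (γ : Γ) : (ofCoeff β f).coeff γ = f γ := rfl

variable {β} in
@[simp] theorem coeff_zero (γ : Γ) : (0 : CrossedProduct β).coeff γ = 0 := rfl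

variable {β} in
@[simp] theorem coeff_add (f h : CrossedProduct β) (γ : Γ) :
    (f + h).coeff γ = f.coeff γ + h.coeff γ := rfl

variable {β} in
@[simp] theorem coeff_smul (c : ℂ) (f : CrossedProduct β) (γ : Γ) :
    (c • f).coeff γ = c • f.coeff γ := rfl

/-- `(a γ)* = γ⁻¹ a* = β_γ(a*) γ⁻¹`. -/
instance : Star (CrossedProduct β) :=
  ⟨fun f => ofCoeff β fun γ => β γ⁻¹ (star (f.coeff γ⁻¹))⟩

variable {β} in
theorem coeff_star (f : CrossedProduct β) (γ : Γ) :
    (star f).coeff γ = β γ⁻¹ (star (f.coeff γ⁻¹)) := rfl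

variable [Fintype Γ] [DecidableEq Γ]

instance : One (CrossedProduct β) := ⟨ofCoeff β fun γ => if γ = 1 then 1 else 0⟩

/-- `(a η) (b δ) = a β_{η⁻¹}(b) η δ`. -/
instance : Mul (CrossedProduct β) :=
  ⟨fun f h => ofCoeff β fun γ => ∑ η : Γ, f.coeff η * β η⁻¹ (h.coeff (η⁻¹ * γ))⟩

variable {β} in
theorem coeff_one (γ : Γ) : (1 : CrossedProduct β).coeff γ = if γ = 1 then 1 else 0 := rfl

variable {β} in
theorem coeff_mul (f h : CrossedProduct β) (γ : Γ) :
    (f * h).coeff γ = ∑ η : Γ, f.coeff η * β η⁻¹ (h.coeff (η⁻¹ * γ)) := rfl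

/-- The underlying function of the matrix expansion map: `a ∈ A` goes to the diagonal matrix with
entries `β_σ(a)`, and `γ ∈ Γ` to the matrix of the shift `e_τ ↦ e_{γτ}`. -/
def expansionFun (f : CrossedProduct β) : CStarMatrix Γ Γ A :=
  CStarMatrix.ofMatrix fun σ τ => β σ (f.coeff (σ * τ⁻¹))

theorem expansionFun_apply (f : CrossedProduct β) (σ τ : Γ) :
    expansionFun β f σ τ = β σ (f.coeff (σ * τ⁻¹)) := rfl

theorem coeff_eq_expansionFun (f : CrossedProduct β) (γ : Γ) :
    f.coeff γ = expansionFun β f 1 γ⁻¹ := by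
  simp [expansionFun_apply]

theorem expansionFun_injective : Function.Injective (expansionFun β) := by
  intro f h H
  ext γ
  rw [coeff_eq_expansionFun, coeff_eq_expansionFun, H]

theorem expansionFun_one : expansionFun β 1 = 1 := by
  ext σ τ
  rw [expansionFun_apply, coeff_one, CStarMatrix.one_apply]
  by_cases h : σ = τ
  · simp [h]
  · rw [if_neg h, if_neg (by rwa [mul_inv_eq_one]), map_zero]

theorem expansionFun_mul (f h : CrossedProduct β) :
    expansionFun β (f * h) = expansionFun β f * expansionFun β h := by
  ext σ τ
  rw [expansionFun_apply, coeff_mul, CStarMatrix.mul_apply, map_sum]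
  refine Fintype.sum_equiv ((Equiv.inv Γ).trans (Equiv.mulRight σ)) _ _ fun η => ?_
  have e1 : σ * (η⁻¹ * σ)⁻¹ = η := by group
  have e2 : η⁻¹ * (σ * τ⁻¹) = η⁻¹ * σ * τ⁻¹ := by group
  simp only [Equiv.trans_apply, Equiv.inv_apply, Equiv.coe_mulRight, expansionFun_apply, e1, e2]
  rw [map_mul, mul_comm η⁻¹ σ, map_mul β σ η⁻¹]
  rfl

theorem expansionFun_star (f : CrossedProduct β) :
    expansionFun β (star f) = star (expansionFun β f) := by
  ext σ τ
  rw [expansionFun_apply, coeff_star, CStarMatrix.star_apply, expansionFun_apply, ← map_star,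
    ← StarAlgEquiv.mul_apply, ← map_mul]
  have e1 : σ * (σ * τ⁻¹)⁻¹ = τ := by simp
  have e2 : (σ * τ⁻¹)⁻¹ = τ * σ⁻¹ := by group
  rw [e1, e2]

theorem expansionFun_add (f h : CrossedProduct β) :
    expansionFun β (f + h) = expansionFun β f + expansionFun β h := by
  ext σ τ
  rw [CStarMatrix.add_apply]
  simp only [expansionFun_apply, coeff_add, map_add]

theorem expansionFun_smul (c : ℂ) (f : CrossedProduct β) :
    expansionFun β (c • f) = c • expansionFun β f := by
  ext σ τ
  rw [CStarMatrix.smul_apply]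
  simp only [expansionFun_apply, coeff_smul, map_smul]

theorem expansionFun_zero : expansionFun β 0 = 0 := by
  ext σ τ
  rw [CStarMatrix.zero_apply, expansionFun_apply, coeff_zero, map_zero]

noncomputable instance : Ring (CrossedProduct β) :=
  { (inferInstance : AddCommGroup (CrossedProduct β)),
    (inferInstance : One (CrossedProduct β)),
    (inferInstance : Mul (CrossedProduct β)) with
    left_distrib := fun a b c => expansionFun_injective β (by
      simp only [expansionFun_mul, expansionFun_add, mul_add])
    right_distrib := fun a b c => expansionFun_injective β (by
      simp only [expansionFun_mul, expansionFun_add, add_mul])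
    zero_mul := fun a => expansionFun_injective β (by
      simp only [expansionFun_mul, expansionFun_zero, zero_mul])
    mul_zero := fun a => expansionFun_injective β (by
      simp only [expansionFun_mul, expansionFun_zero, mul_zero])
    mul_assoc := fun a b c => expansionFun_injective β (by
      simp only [expansionFun_mul, mul_assoc])
    one_mul := fun a => expansionFun_injective β (by
      simp only [expansionFun_mul, expansionFun_one, one_mul])
    mul_one := fun a => expansionFun_injective β (by
      simp only [expansionFun_mul, expansionFun_one, mul_one]) }

noncomputable instance : Algebra ℂ (CrossedProduct β) :=
  Algebra.ofModule
    (fun c f h => expansionFun_injective β (by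
      simp only [expansionFun_mul, expansionFun_smul, smul_mul_assoc]))
    (fun c f h => expansionFun_injective β (by
      simp only [expansionFun_mul, expansionFun_smul, mul_smul_comm]))

noncomputable instance : StarRing (CrossedProduct β) where
  star_involutive f := expansionFun_injective β (by simp only [expansionFun_star, star_star])
  star_mul f h := expansionFun_injective β (by
    simp only [expansionFun_star, expansionFun_mul, star_mul])
  star_add f h := expansionFun_injective β (by
    simp only [expansionFun_star, expansionFun_add, star_add])

instance : StarModule ℂ (CrossedProduct β) where
  star_smul c f := expansionFun_injective β (by
    simp only [expansionFun_star, expansionFun_smul, star_smul])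

/-- The matrix expansion map `A ⋊_β Γ → M_Γ(A)`. -/
noncomputable def expansion : CrossedProduct β →⋆ₐ[ℂ] CStarMatrix Γ Γ A where
  toFun := expansionFun β
  map_one' := expansionFun_one β
  map_mul' := expansionFun_mul β
  map_zero' := expansionFun_zero β
  map_add' := expansionFun_add β
  commutes' c := by
    rw [Algebra.algebraMap_eq_smul_one, expansionFun_smul, expansionFun_one,
      Algebra.algebraMap_eq_smul_one]
  map_star' := expansionFun_star β

theorem expansion_apply (f : CrossedProduct β) (σ τ : Γ) :
    expansion β f σ τ = β σ (f.coeff (σ * τ⁻¹)) := rfl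

theorem expansion_injective : Function.Injective (expansion β) := expansionFun_injective β

/-- The (unique) C*-norm of the crossed product, obtained from the faithful representation
`expansion` on the Hilbert module `A^Γ`. -/
noncomputable instance : NormedRing (CrossedProduct β) :=
  letI := CStarAlgebra.spectralOrder A
  letI := CStarAlgebra.spectralOrderedRing A
  NormedRing.induced (CrossedProduct β) (CStarMatrix Γ Γ A) (expansion β) (expansion_injective β)

noncomputable instance : NormedAlgebra ℂ (CrossedProduct β) :=
  letI := CStarAlgebra.spectralOrder A
  letI := CStarAlgebra.spectralOrderedRing A
  { (inferInstance : Algebra ℂ (CrossedProduct β)) with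
    norm_smul_le := fun c f => by
      change ‖expansion β (c • f)‖ ≤ ‖c‖ * ‖expansion β f‖
      rw [map_smul]
      exact norm_smul_le _ _ }

instance : CStarRing (CrossedProduct β) where
  norm_mul_self_le f := by
    letI := CStarAlgebra.spectralOrder A
    letI := CStarAlgebra.spectralOrderedRing A
    change ‖expansion β f‖ * ‖expansion β f‖ ≤ ‖expansion β (star f * f)‖
    rw [map_mul, map_star]
    exact CStarRing.norm_mul_self_le _

instance : CompleteSpace (CrossedProduct β) := by
  letI := CStarAlgebra.spectralOrder A
  letI := CStarAlgebra.spectralOrderedRing A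
  have hi : Isometry (expansion β) :=
    AddMonoidHomClass.isometry_of_norm (expansion β) fun _ => rfl
  refine (completeSpace_iff_isComplete_range hi.isUniformInducing).2 (IsClosed.isComplete ?_)
  have hcont : ∀ σ τ : Γ, Continuous fun M : CStarMatrix Γ Γ A => M σ τ := fun σ τ =>
    (continuous_apply τ).comp (continuous_apply (A := fun _ : Γ => Γ → A) σ)
  have hr : Set.range (expansion β) =
      ⋂ σ : Γ, ⋂ τ : Γ, {M : CStarMatrix Γ Γ A | M σ τ = β σ (M 1 (τ * σ⁻¹))} := by
    ext M
    simp only [Set.mem_range, Set.mem_iInter, Set.mem_ofPred_eq]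
    constructor
    · rintro ⟨f, rfl⟩ σ τ
      simp [expansion_apply]
    · intro h
      refine ⟨ofCoeff β fun γ => M 1 γ⁻¹, ?_⟩
      ext σ τ
      rw [expansion_apply, coeff_ofCoeff, h σ τ]
      simp
  rw [hr]
  refine isClosed_iInter fun σ => isClosed_iInter fun τ => isClosed_eq (hcont σ τ) ?_
  exact (map_continuous (β σ)).comp (hcont 1 (τ * σ⁻¹))

noncomputable instance : CStarAlgebra (CrossedProduct β) where

/-- The canonical embedding of `A` into the crossed product. -/
noncomputable def ofBase : A →⋆ₐ[ℂ] CrossedProduct β where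
  toFun a := ofCoeff β fun γ => if γ = 1 then a else 0
  map_one' := rfl
  map_mul' a b := by
    ext γ
    rw [coeff_mul, Finset.sum_eq_single 1]
    · simp
    · intro η _ h
      simp [h]
    · simp
  map_zero' := by ext γ; simp
  map_add' a b := by ext γ; simp only [coeff_add, coeff_ofCoeff]; split_ifs <;> simp
  commutes' c := by
    ext γ
    rw [Algebra.algebraMap_eq_smul_one, Algebra.algebraMap_eq_smul_one, coeff_smul, coeff_one,
      coeff_ofCoeff]
    split_ifs <;> simp
  map_star' a := by
    ext γ
    simp only [coeff_star, coeff_ofCoeff, inv_eq_one]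
    split_ifs with h <;> simp [h]

/-- The canonical copy of `Γ` in the crossed product. -/
noncomputable def ofGroup : Γ →* CrossedProduct β where
  toFun δ := ofCoeff β fun γ => if γ = δ then 1 else 0
  map_one' := rfl
  map_mul' δ ε := by
    ext γ
    rw [coeff_mul, Finset.sum_eq_single δ]
    · simp only [coeff_ofCoeff, inv_mul_eq_iff_eq_mul]
      split_ifs <;> simp
    · intro η _ h
      simp [h]
    · simp

theorem ofBase_mul_ofGroup (a : A) (γ : Γ) :
    ofBase β a * ofGroup β γ = ofGroup β γ * ofBase β (β γ a) := by
  ext δ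
  rw [coeff_mul, coeff_mul, Finset.sum_eq_single 1, Finset.sum_eq_single γ]
  · by_cases h : δ = γ
    · have e : (β γ)⁻¹ (β γ a) = a := DFunLike.congr_fun (inv_mul_cancel (β γ)) a
      simp [ofBase, ofGroup, h, e]
    · simp [ofBase, ofGroup, h, inv_mul_eq_one, Ne.symm h]
  · intro η _ h
    simp [ofGroup, h]
  · simp
  · intro η _ h
    simp [ofBase, h]
  · simp

/-- Every element is the sum `∑ γ, f_γ · γ` of its coefficients. -/
theorem eq_sum (f : CrossedProduct β) : f = ∑ γ, ofBase β (f.coeff γ) * ofGroup β γ := by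
  have hs : ∀ (F : Γ → CrossedProduct β) (δ : Γ), (∑ γ, F γ).coeff δ = ∑ γ, (F γ).coeff δ :=
    fun F δ => Finset.sum_apply δ Finset.univ F
  ext δ
  rw [hs, Finset.sum_eq_single δ]
  · rw [coeff_mul, Finset.sum_eq_single 1]
    · simp [ofBase, ofGroup]
    · intro η _ h
      simp [ofBase, h]
    · simp
  · intro γ _ h
    rw [coeff_mul, Finset.sum_eq_single 1]
    · simp [ofBase, ofGroup, Ne.symm h]
    · intro η _ h
      simp [ofBase, h]
    · simp
  · simp

/-- The subalgebra `A` of the crossed product. -/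
noncomputable def baseSubalgebra : StarSubalgebra ℂ (CrossedProduct β) := (ofBase β).range

/-- The subalgebra `C*(Γ)` of the crossed product: the sums `∑ γ, c_γ γ` with complex `c_γ`. -/
noncomputable def groupSubalgebra : StarSubalgebra ℂ (CrossedProduct β) where
  carrier := {f | ∀ γ, ∃ c : ℂ, f.coeff γ = algebraMap ℂ A c}
  mul_mem' := by
    intro f h hf hh γ
    choose c hc using hf
    choose d hd using hh
    refine ⟨∑ η : Γ, c η * d (η⁻¹ * γ), ?_⟩
    rw [coeff_mul, map_sum]
    refine Finset.sum_congr rfl fun η _ => ?_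
    rw [hc, hd, map_mul, AlgHomClass.commutes]
  add_mem' := by
    intro f h hf hh γ
    obtain ⟨c, hc⟩ := hf γ
    obtain ⟨d, hd⟩ := hh γ
    exact ⟨c + d, by rw [coeff_add, hc, hd, map_add]⟩
  algebraMap_mem' := by
    intro c γ
    refine ⟨if γ = 1 then c else 0, ?_⟩
    rw [Algebra.algebraMap_eq_smul_one, coeff_smul, coeff_one, Algebra.algebraMap_eq_smul_one]
    split_ifs <;> simp
  star_mem' := by
    intro f hf γ
    obtain ⟨c, hc⟩ := hf γ⁻¹
    refine ⟨star c, ?_⟩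
    rw [coeff_star, hc, ← algebraMap_star_comm, AlgHomClass.commutes]

end CrossedProduct

/-! ### The twisted join -/

/-- The `β`-twisted join `{f ∈ C([0,1], A ⋊_β Γ) : f(0) ∈ C*(Γ), f(1) ∈ A}`. -/
noncomputable def TwistedJoin (β : Γ →* (A ≃⋆ₐ[ℂ] A)) [Fintype Γ] [DecidableEq Γ] :
    StarSubalgebra ℂ C(unitInterval, CrossedProduct β) where
  carrier := {f | f 0 ∈ CrossedProduct.groupSubalgebra β ∧ f 1 ∈ CrossedProduct.baseSubalgebra β}
  mul_mem' := fun hf hh => ⟨mul_mem hf.1 hh.1, mul_mem hf.2 hh.2⟩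
  add_mem' := fun hf hh => ⟨add_mem hf.1 hh.1, add_mem hf.2 hh.2⟩
  algebraMap_mem' := fun c => ⟨algebraMap_mem _ c, algebraMap_mem _ c⟩
  star_mem' := fun hf => ⟨star_mem hf.1, star_mem hf.2⟩

end Crossed

/-! ### The induced action on the crossed product and on the twisted join -/

section Induced

/-- A monoid homomorphism from a group to the `*`-endomorphisms takes values in the
`*`-automorphisms. -/
def toStarAut {G X : Type*} [Group G] [Ring X] [StarRing X] [Algebra ℂ X]
    (F : G →* (X →⋆ₐ[ℂ] X)) : G →* (X ≃⋆ₐ[ℂ] X) where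
  toFun g := StarAlgEquiv.ofStarAlgHom (F g) (F g⁻¹)
    (by
      change F g⁻¹ * F g = 1
      rw [← map_mul, inv_mul_cancel, map_one])
    (by
      change F g * F g⁻¹ = 1
      rw [← map_mul, mul_inv_cancel, map_one])
  map_one' := by
    ext x
    change F 1 x = x
    rw [map_one]; rfl
  map_mul' g h := by
    ext x
    change F (g * h) x = F g (F h x)
    rw [map_mul]; rfl

variable {A : Type*} [CStarAlgebra A] {G : Type*} [AddCommGroup G] [Finite G]
  [DecidableEq (AddChar G ℂ)]
  (α : Multiplicative G →* (A ≃⋆ₐ[ℂ] A)) (β : AddChar G ℂ →* (A ≃⋆ₐ[ℂ] A))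
  (hαβ : ∀ g γ, Commute (α g) (β γ))

theorem star_addChar_inv (γ : AddChar G ℂ) (g : G) : star (γ⁻¹ g) = γ g := by
  rw [AddChar.inv_apply, AddChar.map_neg_eq_conj, ← starRingEnd_apply, Complex.conj_conj]

/-- The `*`-endomorphism `∑ γ, a_γ γ ↦ ∑ γ, α_g(a_γ) γ(g) γ` of the crossed product. -/
noncomputable def dualTwistHom (g : Multiplicative G) :
    CrossedProduct β →⋆ₐ[ℂ] CrossedProduct β where
  toFun f := CrossedProduct.ofCoeff β fun γ => γ g.toAdd • α g (f.coeff γ)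
  map_one' := by
    ext γ
    simp only [CrossedProduct.coeff_ofCoeff, CrossedProduct.coeff_one]
    split_ifs with h
    · simp [h]
    · simp
  map_mul' f h := by
    ext γ
    simp only [CrossedProduct.coeff_ofCoeff, CrossedProduct.coeff_mul, map_sum, Finset.smul_sum]
    refine Finset.sum_congr rfl fun η _ => ?_
    have e : α g (β η⁻¹ (h.coeff (η⁻¹ * γ))) = β η⁻¹ (α g (h.coeff (η⁻¹ * γ))) :=
      DFunLike.congr_fun (hαβ g η⁻¹).eq (h.coeff (η⁻¹ * γ))
    have e2 : γ g.toAdd = η g.toAdd * (η⁻¹ * γ) g.toAdd := by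
      rw [← AddChar.mul_apply, mul_inv_cancel_left]
    rw [map_mul, e, map_smul, smul_mul_smul_comm, ← e2]
  map_zero' := by ext γ; simp
  map_add' f h := by ext γ; simp
  commutes' c := by
    ext γ
    rw [Algebra.algebraMap_eq_smul_one]
    simp only [CrossedProduct.coeff_ofCoeff, CrossedProduct.coeff_smul, CrossedProduct.coeff_one]
    split_ifs with h
    · simp [h]
    · simp
  map_star' f := by
    ext γ
    simp only [CrossedProduct.coeff_ofCoeff, CrossedProduct.coeff_star]
    have e : ∀ x, α g (β γ⁻¹ x) = β γ⁻¹ (α g x) := DFunLike.congr_fun (hαβ g γ⁻¹).eq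
    rw [e, star_smul, map_smul, map_star (α g), star_addChar_inv]

/-- The action `α β̂` of `G` on the crossed product of `A` by the dual group of `G`,
`∑ γ, a_γ γ ↦ ∑ γ, α_g(a_γ) γ(g) γ`. -/
noncomputable def dualTwist :
    Multiplicative G →* (CrossedProduct β ≃⋆ₐ[ℂ] CrossedProduct β) :=
  toStarAut
    { toFun := dualTwistHom α β hαβ
      map_one' := by
        ext f γ
        change γ 0 • α 1 (f.coeff γ) = f.coeff γ
        simp
      map_mul' := fun g h => by
        ext f γ
        change γ (g.toAdd + h.toAdd) • α (g * h) (f.coeff γ) =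
          γ g.toAdd • α g (γ h.toAdd • α h (f.coeff γ))
        rw [AddChar.map_add_eq_mul, map_mul, map_smul, mul_smul]
        rfl }

theorem coeff_dualTwist (g : Multiplicative G) (f : CrossedProduct β) (γ : AddChar G ℂ) :
    (dualTwist α β hαβ g f).coeff γ = γ g.toAdd • α g (f.coeff γ) := rfl

theorem dualTwist_mem_group (g : Multiplicative G) {f : CrossedProduct β}
    (hf : f ∈ CrossedProduct.groupSubalgebra β) :
    dualTwist α β hαβ g f ∈ CrossedProduct.groupSubalgebra β := by
  intro γ
  obtain ⟨c, hc⟩ := hf γ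
  refine ⟨γ g.toAdd * c, ?_⟩
  rw [coeff_dualTwist, hc, AlgHomClass.commutes, map_mul, Algebra.smul_def]

theorem dualTwist_mem_base (g : Multiplicative G) {f : CrossedProduct β}
    (hf : f ∈ CrossedProduct.baseSubalgebra β) :
    dualTwist α β hαβ g f ∈ CrossedProduct.baseSubalgebra β := by
  obtain ⟨a, rfl⟩ := hf
  refine ⟨α g a, ?_⟩
  ext γ
  change (if γ = 1 then α g a else 0) = γ g.toAdd • α g (if γ = 1 then a else 0)
  split_ifs with h
  · simp [h]
  · simp

/-- The pointwise application of `α β̂` as a `*`-endomorphism of the twisted join. -/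
noncomputable def twistedJoinHom (g : Multiplicative G) : TwistedJoin β →⋆ₐ[ℂ] TwistedJoin β where
  toFun f := ⟨⟨fun t => dualTwist α β hαβ g (f.1 t),
      (map_continuous (dualTwist α β hαβ g)).comp f.1.continuous⟩,
    dualTwist_mem_group α β hαβ g f.2.1, dualTwist_mem_base α β hαβ g f.2.2⟩
  map_one' := Subtype.ext (ContinuousMap.ext fun _ => map_one (dualTwist α β hαβ g))
  map_mul' f h := Subtype.ext (ContinuousMap.ext fun t =>
    map_mul (dualTwist α β hαβ g) (f.1 t) (h.1 t))
  map_zero' := Subtype.ext (ContinuousMap.ext fun _ => map_zero (dualTwist α β hαβ g))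
  map_add' f h := Subtype.ext (ContinuousMap.ext fun t =>
    map_add (dualTwist α β hαβ g) (f.1 t) (h.1 t))
  commutes' c := Subtype.ext (ContinuousMap.ext fun _ =>
    AlgHomClass.commutes (dualTwist α β hαβ g) c)
  map_star' f := Subtype.ext (ContinuousMap.ext fun t => map_star (dualTwist α β hαβ g) (f.1 t))

/-- The action `α̃` of `G` on the twisted join: the pointwise application of `α β̂`. -/
noncomputable def twistedJoinAction : Multiplicative G →* (TwistedJoin β ≃⋆ₐ[ℂ] TwistedJoin β) :=
  toStarAut
    { toFun := twistedJoinHom α β hαβ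
      map_one' := by
        refine StarAlgHom.ext fun f => Subtype.ext (ContinuousMap.ext fun t => ?_)
        change dualTwist α β hαβ 1 (f.1 t) = f.1 t
        rw [map_one]; rfl
      map_mul' := fun g h => by
        refine StarAlgHom.ext fun f => Subtype.ext (ContinuousMap.ext fun t => ?_)
        change dualTwist α β hαβ (g * h) (f.1 t) =
          dualTwist α β hαβ g (dualTwist α β hαβ h (f.1 t))
        rw [map_mul]; rfl }

theorem twistedJoinAction_apply (g : Multiplicative G) (f : TwistedJoin β) (t : unitInterval) :
    (twistedJoinAction α β hαβ g f).1 t = dualTwist α β hαβ g (f.1 t) := rfl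

end Induced

/-! Suppose `φ` exists and follow `u = φ x`, a path of `k`-th roots of unity in the crossed product.
Equivariance makes `u 0` a `μ`-isotypic element of `C*(Γ)`, so `u 0 = c μ` with a scalar `c`, and `c
^ k = 1` (`exists_eq_smul_ofGroup`). The other end `u 1` is an element `a` of `A`.

Modulo the ideal `I` the action `β` is trivial. Hence every `g ∈ G`, read as the character `γ ↦ γ g`
of `Γ`, gives a homomorphism `∑ a_γ γ ↦ ∑ γ(g) [a_γ]` to `A/I` (`evalCharacter`). It sends `u` to a
family of `k`-th roots of unity in `A/I` that starts at the scalar `c μ(g)`. The spectrum of such an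
element lies in a finite set, and its spectral idempotents cannot jump along a path, so the family
stays equal to this scalar (`RingHom.map_eq_one_of_pow_eq_one_of_preconnected`, applied in
`CrossedProduct.mk_eq_of_path`).

At the other end every one of these homomorphisms gives `[a]`, whatever `g` is. So `[a] = c μ(g)`
for all `g`. Since `μ` is nontrivial, two different scalars coincide in `A/I`, which is impossible
because `I` is proper. -/

/-! ### Paths of idempotents and of roots of unity modulo a closed ideal -/

section Paths

variable {X B C : Type*} [TopologicalSpace X] [PreconnectedSpace X] [NormedRing B] [Ring C]

/-- A continuous family of idempotents over a connected space which meets the closed kernel of a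
ring homomorphism lies in this kernel. -/
theorem RingHom.map_idempotent_eq_zero_of_preconnected (π : B →+* C)
    (hπ : IsClosed {b : B | π b = 0}) {e : X → B} (he : Continuous e)
    (hi : ∀ t, IsIdempotentElem (e t)) {s : X} (hs : π (e s) = 0) (t : X) : π (e t) = 0 := by
  have hclosed : IsClosed {t | π (e t) = 0} := hπ.preimage he
  have hopen : IsOpen {t | π (e t) = 0} := by
    refine isOpen_iff_mem_nhds.2 fun r (hr : π (e r) = 0) => ?_
    filter_upwards [Metric.continuousAt_iff'.1 he.continuousAt 1 one_pos] with w hw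
    rw [dist_eq_norm] at hw
    -- An idempotent of norm less than `1` vanishes; here this is applied modulo the kernel. Since
    -- `π (e r) = 0`, the element `(e w - e r) ^ (n + 1)` has the same image as `e w ^ (n + 1) = e
    -- w`, while its norm tends to `0`. Thus `e w` is a limit of elements of the closed kernel, and
    -- `C` needs no topology.
    have hlim : Filter.Tendsto (fun n : ℕ => e w - (e w - e r) ^ (n + 1)) Filter.atTop
        (nhds (e w - 0)) :=
      tendsto_const_nhds.sub
        ((tendsto_pow_atTop_nhds_zero_of_norm_lt_one hw).comp (Filter.tendsto_add_atTop_nat 1))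
    rw [sub_zero] at hlim
    refine hπ.mem_of_tendsto hlim (Filter.Eventually.of_forall fun n => ?_)
    change π (e w - (e w - e r) ^ (n + 1)) = 0
    rw [map_sub, map_pow, map_sub, hr, sub_zero, ← map_pow, (hi w).pow_succ_eq, sub_self]
  have huniv := IsClopen.eq_univ ⟨hclosed, hopen⟩ ⟨s, hs⟩
  exact huniv.ge (Set.mem_univ t)

/-- The average of the powers of an element `v` with `v ^ k = 1`. -/
noncomputable def powerMean [Algebra ℂ B] (k : ℕ) (v : B) : B :=
  (k : ℂ)⁻¹ • ∑ j ∈ Finset.range k, v ^ j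

/-- Multiplication by `v` permutes the powers `v ^ 0, …, v ^ (k - 1)` cyclically, because `v ^ k = v
^ 0`. So `powerMean k v` is the spectral idempotent of `v` at the eigenvalue `1`. -/
theorem mul_powerMean [Algebra ℂ B] {k : ℕ} {v : B} (hv : v ^ k = 1) :
    v * powerMean k v = powerMean k v := by
  -- The sum of the powers with exponents `0, …, k` is split off at its last and at its first term;
  -- both of these are `1`.
  have h := Finset.sum_range_succ (fun j => v ^ j) k
  rw [Finset.sum_range_succ', hv, pow_zero] at h
  rw [powerMean, mul_smul_comm, Finset.mul_sum]
  simp only [← pow_succ']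
  rw [add_right_cancel h]

theorem powerMean_of_eq_one [Algebra ℂ B] {k : ℕ} [NeZero k] : powerMean k (1 : B) = 1 := by
  have hk : (k : ℂ) ≠ 0 := Nat.cast_ne_zero.2 (NeZero.ne k)
  have h : (k : B) = (k : ℂ) • (1 : B) := by rw [← Algebra.algebraMap_eq_smul_one, map_natCast]
  simp [powerMean, h, smul_smul, hk]

/-- The mean absorbs every power of `v`, hence also the average of these powers, which is the mean
itself. -/
theorem isIdempotentElem_powerMean [Algebra ℂ B] {k : ℕ} [NeZero k] {v : B} (hv : v ^ k = 1) :
    IsIdempotentElem (powerMean k v) := by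
  have hk : (k : ℂ) ≠ 0 := Nat.cast_ne_zero.2 (NeZero.ne k)
  have hp : ∀ j, v ^ j * powerMean k v = powerMean k v := fun j => by
    induction j with
    | zero => simp
    | succ j ih => rw [pow_succ, mul_assoc, mul_powerMean hv, ih]
  change powerMean k v * powerMean k v = powerMean k v
  conv_lhs => enter [1]; rw [powerMean]
  rw [smul_mul_assoc, Finset.sum_mul, Finset.sum_congr rfl fun j _ => hp j, Finset.sum_const,
    Finset.card_range, ← Nat.cast_smul_eq_nsmul ℂ, smul_smul, inv_mul_cancel₀ hk, one_smul]

/-- A continuous family of `k`-th roots of unity over a connected space which is trivial at one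
point modulo a closed ideal is trivial everywhere modulo this ideal. -/
theorem RingHom.map_eq_one_of_pow_eq_one_of_preconnected [NormedAlgebra ℂ B] (π : B →+* C)
    (hπ : IsClosed {b : B | π b = 0}) {k : ℕ} [NeZero k] {v : X → B} (hv : Continuous v)
    (hk : ∀ t, v t ^ k = 1) {s : X} (hs : π (v s) = 1) (t : X) : π (v t) = 1 := by
  have hcont : Continuous fun t => 1 - powerMean k (v t) :=
    continuous_const.sub
      ((continuous_finsetSum _ fun j _ => hv.pow j).const_smul (k : ℂ)⁻¹)
  have h1 : π (1 - powerMean k (v s)) = 0 := by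
    have e : powerMean k (1 : B) = 1 := powerMean_of_eq_one
    have hs' : ∀ j, π (v s ^ j) = π (1 ^ j) := fun j => by
      rw [map_pow, map_pow, hs, map_one]
    have hsum : π (∑ j ∈ Finset.range k, v s ^ j) = π (∑ j ∈ Finset.range k, 1 ^ j) := by
      rw [map_sum, map_sum, Finset.sum_congr rfl fun j _ => hs' j]
    conv_lhs => rw [← e]
    -- `π` is only a ring homomorphism, so the scalar `1 / k` is turned into left multiplication by
    -- an element of `B` before `π` is applied.
    rw [powerMean, powerMean, ← smul_sub, ← one_mul (Finset.sum _ _ - _), ← smul_mul_assoc,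
      map_mul, map_sub, hsum, sub_self, mul_zero]
  have h2 := π.map_idempotent_eq_zero_of_preconnected hπ hcont
    (fun t => (isIdempotentElem_powerMean (hk t)).one_sub) h1 t
  rw [map_sub, map_one, sub_eq_zero] at h2
  -- Now `powerMean k (v t)` is `1` modulo the kernel, and it absorbs `v t`; so `v t` is `1` as
  -- well.
  have h3 := congrArg π (mul_powerMean (hk t))
  rwa [map_mul, ← h2, mul_one] at h3

end Paths

/-! ### Characters of the crossed product with values in the quotient of coinvariants -/

section Evaluation

variable {A : Type*} [CStarAlgebra A] {Γ : Type*} [CommGroup Γ] (β : Γ →* (A ≃⋆ₐ[ℂ] A))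

theorem isClosed_coinvariantIdeal : IsClosed {a : A | a ∈ coinvariantIdeal β} := by
  have h : {a : A | a ∈ coinvariantIdeal β} = ⋂ J ∈ {J : TwoSidedIdeal A |
      IsClosed (J : Set A) ∧ ∀ (γ : Γ) (a : A), β γ a - a ∈ J}, (J : Set A) := by
    ext a
    simp only [coinvariantIdeal, TwoSidedIdeal.mem_sInf, Set.mem_iInter]
    rfl
  rw [h]
  exact isClosed_biInter fun J hJ => hJ.1

theorem CoinvariantQuotient.mk_eq_zero_iff (a : A) :
    CoinvariantQuotient.mk β a = 0 ↔ a ∈ coinvariantIdeal β := by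
  rw [← map_zero (CoinvariantQuotient.mk β), CoinvariantQuotient.mk_eq_mk_iff, sub_zero]

/-- This removes the twist from the product of the crossed product and makes `evalCharacter`
multiplicative. -/
theorem CoinvariantQuotient.mk_apply (γ : Γ) (a : A) :
    CoinvariantQuotient.mk β (β γ a) = CoinvariantQuotient.mk β a := by
  rw [CoinvariantQuotient.mk_eq_mk_iff, coinvariantIdeal, TwoSidedIdeal.mem_sInf]
  exact fun {J} hJ => hJ.2 γ a

variable {β} in
/-- A proper ideal contains no nonzero scalar. -/
theorem CoinvariantQuotient.mk_algebraMap_injective (hI : coinvariantIdeal β ≠ ⊤) :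
    Function.Injective fun c : ℂ => CoinvariantQuotient.mk β (algebraMap ℂ A c) := by
  intro c d (h : CoinvariantQuotient.mk β _ = CoinvariantQuotient.mk β _)
  by_contra hcd
  refine hI (TwoSidedIdeal.one_mem_iff _ |>.1 ?_)
  rw [CoinvariantQuotient.mk_eq_mk_iff, ← map_sub] at h
  have h' := (coinvariantIdeal β).mul_mem_left (algebraMap ℂ A (c - d)⁻¹) _ h
  rwa [← map_mul, inv_mul_cancel₀ (sub_ne_zero.2 hcd), map_one] at h'

namespace CrossedProduct

variable [Fintype Γ] [DecidableEq Γ]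

/-- The norm is defined so that `expansion` is isometric, and the coefficient of `γ` is the matrix
entry in row `1` and column `γ⁻¹`. -/
theorem continuous_coeff (γ : Γ) : Continuous fun f : CrossedProduct β => f.coeff γ := by
  letI := CStarAlgebra.spectralOrder A
  letI := CStarAlgebra.spectralOrderedRing A
  have hi : Isometry (expansion β) :=
    AddMonoidHomClass.isometry_of_norm (expansion β) fun _ => rfl
  have hcont : Continuous fun M : CStarMatrix Γ Γ A => M 1 γ⁻¹ :=
    (continuous_apply γ⁻¹).comp (continuous_apply (A := fun _ : Γ => Γ → A) 1)
  have h := hcont.comp hi.continuous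
  convert h using 2 with f
  exact coeff_eq_expansionFun β f γ

/-- The homomorphism `∑ γ, a_γ γ ↦ ∑ γ, χ(γ) [a_γ]` from the crossed product to the quotient of
coinvariants, for a character `χ` of `Γ`. -/
noncomputable def evalCharacter (χ : Γ →* ℂ) : CrossedProduct β →+* CoinvariantQuotient β where
  toFun f := CoinvariantQuotient.mk β (∑ γ, χ γ • f.coeff γ)
  map_one' := by
    rw [Finset.sum_eq_single 1]
    · simp [coeff_one]
    · intro γ _ h
      simp [coeff_one, h]
    · simp
  map_zero' := by simp
  map_add' f h := by
    simp only [coeff_add, smul_add, Finset.sum_add_distrib, map_add]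
  map_mul' f h := by
    -- The twist `β η⁻¹` disappears in the quotient, and `χ γ` splits as `χ η * χ (η⁻¹ * γ)`.
    have e : ∀ γ η : Γ, CoinvariantQuotient.mk β
          (χ γ • (f.coeff η * β η⁻¹ (h.coeff (η⁻¹ * γ)))) =
        CoinvariantQuotient.mk β (χ η • f.coeff η) *
          CoinvariantQuotient.mk β (χ (η⁻¹ * γ) • h.coeff (η⁻¹ * γ)) := fun γ η => by
      rw [← CoinvariantQuotient.mk_apply β η⁻¹ (χ (η⁻¹ * γ) • h.coeff (η⁻¹ * γ)), ← map_mul,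
        map_smul (β η⁻¹), smul_mul_smul_comm, ← map_mul χ, mul_inv_cancel_left]
    simp only [coeff_mul, Finset.smul_sum, map_sum, e]
    rw [Finset.sum_comm, Finset.sum_mul]
    refine Finset.sum_congr rfl fun η _ => ?_
    rw [Finset.mul_sum]
    exact Fintype.sum_equiv (Equiv.mulLeft η⁻¹) _ _ fun γ => rfl

theorem evalCharacter_apply (χ : Γ →* ℂ) (f : CrossedProduct β) :
    evalCharacter β χ f = CoinvariantQuotient.mk β (∑ γ, χ γ • f.coeff γ) := rfl

theorem evalCharacter_ofBase (χ : Γ →* ℂ) (a : A) :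
    evalCharacter β χ (ofBase β a) = CoinvariantQuotient.mk β a := by
  rw [evalCharacter_apply, Finset.sum_eq_single 1]
  · simp [ofBase]
  · intro γ _ h
    simp [ofBase, h]
  · simp

theorem evalCharacter_ofGroup (χ : Γ →* ℂ) (γ : Γ) :
    evalCharacter β χ (ofGroup β γ) = CoinvariantQuotient.mk β (algebraMap ℂ A (χ γ)) := by
  rw [evalCharacter_apply, Finset.sum_eq_single γ]
  · simp [ofGroup, Algebra.algebraMap_eq_smul_one]
  · intro η _ h
    simp [ofGroup, h]
  · simp

/-- The map lifts to a continuous map with values in `A`, and the kernel is the preimage of the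
closed ideal under this lift. -/
theorem isClosed_ker_evalCharacter (χ : Γ →* ℂ) :
    IsClosed {f : CrossedProduct β | evalCharacter β χ f = 0} := by
  have h : {f : CrossedProduct β | evalCharacter β χ f = 0} =
      (fun f => ∑ γ, χ γ • f.coeff γ) ⁻¹' {a : A | a ∈ coinvariantIdeal β} := by
    ext f
    exact CoinvariantQuotient.mk_eq_zero_iff β _
  rw [h]
  exact (isClosed_coinvariantIdeal β).preimage
    (continuous_finsetSum _ fun γ _ => (continuous_coeff β γ).const_smul (χ γ))

variable {β} in
/-- A path of `k`-th roots of unity in the crossed product that starts at `c μ` and ends in `A`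
ends at the scalar `c χ(μ)` modulo the ideal of coinvariants, for each character `χ`. -/
theorem mk_eq_of_path (χ : Γ →* ℂ) {k : ℕ} [NeZero k] {u : C(unitInterval, CrossedProduct β)}
    (hu : u ^ k = 1) {c : ℂ} (hc : c ^ k = 1) {μ : Γ} (hμ : μ ^ k = 1)
    (h0 : u 0 = c • ofGroup β μ) {a : A} (h1 : u 1 = ofBase β a) :
    CoinvariantQuotient.mk β a = CoinvariantQuotient.mk β (algebraMap ℂ A (c * χ μ)) := by
  -- The starting value `c * χ μ` is itself a `k`-th root of unity, so dividing the path by it keeps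
  -- `k`-th roots of unity and makes the path start at `1` modulo the kernel.
  have hl : (c * χ μ) ^ k = 1 := by rw [mul_pow, hc, ← map_pow, hμ, map_one, mul_one]
  have hl0 : c * χ μ ≠ 0 := fun h => by
    rw [h, zero_pow (NeZero.ne k)] at hl
    exact zero_ne_one hl
  -- `evalCharacter` is a ring homomorphism to a quotient ring without a scalar action; complex
  -- scalars are carried through as elements of `A`.
  have hscalar : ∀ (d : ℂ) (f : CrossedProduct β), evalCharacter β χ (d • f) =
      CoinvariantQuotient.mk β (algebraMap ℂ A d) * evalCharacter β χ f := fun d f => by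
    rw [Algebra.smul_def, map_mul, ← AlgHomClass.commutes (ofBase β), evalCharacter_ofBase]
  have hcont : Continuous fun t => (c * χ μ)⁻¹ • u t :=
    (continuous_const_smul (c * χ μ)⁻¹).comp u.continuous
  have h := (evalCharacter β χ).map_eq_one_of_pow_eq_one_of_preconnected
    (isClosed_ker_evalCharacter β χ) (k := k) (v := fun t => (c * χ μ)⁻¹ • u t)
    hcont
    (fun t => by
      have ht : u t ^ k = 1 := DFunLike.congr_fun hu t
      rw [smul_pow, inv_pow, hl, ht, inv_one, one_smul])
    (s := 0)
    (by
      rw [hscalar, h0, hscalar, evalCharacter_ofGroup, ← map_mul, ← map_mul, ← map_mul,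
        ← map_mul, inv_mul_cancel₀ hl0, map_one, map_one]) 1
  simp only [h1, hscalar, evalCharacter_ofBase] at h
  calc CoinvariantQuotient.mk β a
      = CoinvariantQuotient.mk β (algebraMap ℂ A (c * χ μ)) *
          (CoinvariantQuotient.mk β (algebraMap ℂ A (c * χ μ)⁻¹) *
            CoinvariantQuotient.mk β a) := by
        rw [← map_mul, ← map_mul, ← mul_assoc, ← map_mul, mul_inv_cancel₀ hl0, map_one, one_mul]
    _ = _ := by rw [h, mul_one]

end CrossedProduct

end Evaluation

/-! ### The isotypic starting point and the contradiction -/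

/-- An element of `C*(Γ)` in the `μ`-isotypic subspace of the twisted dual action is a multiple of
the group element `μ`. -/
theorem exists_eq_smul_ofGroup {A : Type*} [CStarAlgebra A] {G : Type*} [AddCommGroup G] [Finite G]
    [Fintype (AddChar G ℂ)] [DecidableEq (AddChar G ℂ)]
    (α : Multiplicative G →* (A ≃⋆ₐ[ℂ] A)) (β : AddChar G ℂ →* (A ≃⋆ₐ[ℂ] A))
    (hαβ : ∀ g γ, Commute (α g) (β γ)) {μ : AddChar G ℂ} {f : CrossedProduct β}
    (hf : f ∈ CrossedProduct.groupSubalgebra β)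
    (hμ : ∀ g : Multiplicative G, dualTwist α β hαβ g f = μ g.toAdd • f) :
    ∃ c : ℂ, f = c • CrossedProduct.ofGroup β μ := by
  obtain ⟨c, hc⟩ := hf μ
  refine ⟨c, CrossedProduct.ext fun γ => ?_⟩
  by_cases h : γ = μ
  · subst h
    simp [CrossedProduct.ofGroup, hc, Algebra.algebraMap_eq_smul_one]
  -- The coefficient at `γ` is a scalar `d`, which `α` fixes. Isotypy then reads `γ(g) d = μ(g) d`
  -- in `A`, and for a `g` that separates `γ` from `μ` this forces the coefficient to vanish.
  · obtain ⟨g, hg⟩ := DFunLike.ne_iff.1 h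
    obtain ⟨d, hd⟩ := hf γ
    have e := congrArg (fun f => CrossedProduct.coeff f γ) (hμ (Multiplicative.ofAdd g))
    simp only [coeff_dualTwist, CrossedProduct.coeff_smul, hd, AlgHomClass.commutes,
      toAdd_ofAdd] at e
    rw [← sub_eq_zero, ← sub_smul, smul_eq_zero, or_iff_right (sub_ne_zero.2 hg)] at e
    simp [CrossedProduct.ofGroup, hd, e, h]

theorem mainTheorem2 {A : Type*} [CStarAlgebra A] (k : ℕ) [NeZero k] (hk : 2 ≤ k)
    (μ : AddChar (ZMod k) ℂ) (hμ : Subgroup.zpowers μ = ⊤)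
    (α : Multiplicative (ZMod k) →* (A ≃⋆ₐ[ℂ] A)) (hα : IsFreeAction α)
    (hx : ∃ x ∈ unitary A, x ∈ isotypic α μ ∧ x ^ k = 1)
    (β : AddChar (ZMod k) ℂ →* (A ≃⋆ₐ[ℂ] A)) (hαβ : ∀ g γ, Commute (α g) (β γ))
    (hI : coinvariantIdeal β ≠ ⊤)
    (hK : ¬ ∃ y : KZeroGroup (CoinvariantQuotient β),
      k • y = KZeroGroup.unitClass (CoinvariantQuotient β)) :
    ¬ ∃ φ : A →⋆ₐ[ℂ] TwistedJoin β,
      ∀ (g : Multiplicative (ZMod k)) (a : A), φ (α g a) = twistedJoinAction α β hαβ g (φ a) := by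
  rintro ⟨φ, hφ⟩
  obtain ⟨x, -, hxμ, hxk⟩ := hx
  have hu : (φ x).1 ^ k = 1 := by
    have h := congrArg φ hxk
    rw [map_pow, map_one] at h
    exact congrArg Subtype.val h
  have hiso : ∀ g : Multiplicative (ZMod k),
      dualTwist α β hαβ g ((φ x).1 0) = μ g.toAdd • (φ x).1 0 := fun g => by
    rw [← twistedJoinAction_apply, ← hφ]
    have h : α g x = μ g.toAdd • x := hxμ g.toAdd
    rw [h, map_smul]
    rfl
  obtain ⟨c, h0⟩ := exists_eq_smul_ofGroup α β hαβ (φ x).2.1 hiso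
  obtain ⟨a, h1⟩ := (φ x).2.2
  have hμk : μ ^ k = 1 := by
    ext g
    rw [AddChar.pow_apply, ← AddChar.map_nsmul_eq_pow, nsmul_eq_mul, ZMod.natCast_self, zero_mul,
      AddChar.map_zero_eq_one, AddChar.one_apply]
  have hinj := CoinvariantQuotient.mk_algebraMap_injective hI
  -- Since `μ ^ k = 1`, the equation `u 0 ^ k = 1` becomes `c ^ k • 1 = 1`. Its coefficient at the
  -- trivial character is compared in `A/I`, where scalars embed.
  have hck : c ^ k = 1 := by
    refine hinj ?_
    have h : (φ x).1 0 ^ k = 1 := DFunLike.congr_fun hu 0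
    rw [h0, smul_pow, ← map_pow, hμk, map_one] at h
    have h' := congrArg (fun f => CoinvariantQuotient.mk β (CrossedProduct.coeff f 1)) h
    simpa [CrossedProduct.coeff_one, Algebra.algebraMap_eq_smul_one] using h'
  -- A trivial generator would leave one character only, but the dual of `ZMod k` has `k ≥ 2`
  -- elements.
  have hμ1 : μ ≠ 1 := by
    rintro rfl
    rw [Subgroup.zpowers_one_eq_bot] at hμ
    have h1 : ∀ γ : AddChar (ZMod k) ℂ, γ = 1 := fun γ =>
      Subgroup.mem_bot.1 (hμ.ge (Subgroup.mem_top γ))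
    have hs : Subsingleton (AddChar (ZMod k) ℂ) := ⟨fun γ δ => (h1 γ).trans (h1 δ).symm⟩
    have hcard := AddChar.card_eq (α := ZMod k)
    rw [ZMod.card] at hcard
    have := Fintype.card_le_one_iff_subsingleton.2 hs
    omega
  obtain ⟨g, hg⟩ := DFunLike.ne_iff.1 hμ1
  let χ (g : ZMod k) : AddChar (ZMod k) ℂ →* ℂ :=
    { toFun := fun γ => γ g, map_one' := rfl, map_mul' := fun _ _ => rfl }
  -- The left side does not depend on `g`: the end of the path lies in `A`, where all the
  -- evaluations agree.
  have key : ∀ g, CoinvariantQuotient.mk β a =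
      CoinvariantQuotient.mk β (algebraMap ℂ A (c * μ g)) := fun g =>
    CrossedProduct.mk_eq_of_path (χ g) hu hck hμk h0 h1.symm
  have hc0 : c ≠ 0 := fun h => by
    rw [h, zero_pow (NeZero.ne k)] at hck
    exact zero_ne_one hck
  -- Comparison with the point `0`, where `μ` takes the value `1`.
  have h := mul_left_cancel₀ hc0 (hinj ((key g).symm.trans (key 0)))
  exact hg (by rw [h, AddChar.map_zero_eq_one, AddChar.one_apply])
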